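/- Let $X$ be a locale with frame of opens $\mathcal{O}X$. A localic relation on $X$ is a sublocale $r\colon R\rightarrowtail X\times X$; its source and target maps are $s=\mathrm{pr}_1\circ r$ and $t=\mathrm{pr}_2\circ r$. It is a localic equivalence relation if it is reflexive ($\Delta\subseteq R$, with $\Delta$ the diagonal), symmetric ($R=R^{\mathrm{op}}$, where $R^{\mathrm{op}}$ is the relation with source $t$ and target $s$) and transitive ($R\circ R\subseteq R$, where $R\circ R$ is the image sublocale of $(s\pi_1,t\pi_2)\colon R\times_X^{t,s}R\to X\times X$). It has open cones if $s$ and $t$ are open, i.e. $s^{-1}$ and $t^{-1}$ have left adjoints $s_!$ and $t_!$ that satisfy Frobenius reciprocity $f_!(U\wedge f^{-1}(V))=f_!(U)\wedge V$. In that case its cones are the maps $\mathord{\uparrow}=t_!s^{-1}$ and $\mathord{\downarrow}=s_!t^{-1}$ on $\mathcal{O}X$. On the rectangles of the coproduct frame $\mathcal{O}X\otimes\mathcal{O}X=\mathcal{O}(X\times X)$ put $$A\otimes B\sim C\otimes D\iff \mathord{\uparrow}A\wedge B=\mathord{\uparrow}C\wedge D\ \text{ and }\ A\wedge\mathord{\downarrow}B=C\wedge\mathord{\downarrow}D,$$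 and let $R_{\uparrow\downarrow}\rightarrowtail X\times X$ be the sublocale whose frame is the quotient of $\mathcal{O}X\otimes\mathcal{O}X$ by the frame congruence generated by $\sim$ (equivalently, the sublocale set of all $\sim$-saturated elements). **Proposition.** Let $R$ be a localic equivalence relation with open cones on a locale $X$, let $q\colon X\to X/R$ be the coequaliser of $s$ and $t$ in the category of locales, and let $X\times_{X/R}X$ be the pullback of $q$ along itself, with its canonical map to $X\times X$. Then there is an isomorphism $R_{\uparrow\downarrow}\cong X\times_{X/R}X$ of locales over $X\times X$. Moreover $R\subseteq R_{\uparrow\downarrow}$, and under this isomorphism the inclusion $R\rightarrowtail R_{\uparrow\downarrow}$ is Kock's inclusion of $R$ into its kernel pair, that is, the map $R\to X\times_{X/R}X$ induced by $s$ and $t$. -/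

import Mathlib

open CategoryTheory CategoryTheory.Limits

universe u

namespace LocalicRel

/-! ### Sublocales generated by a binary relation on a frame -/

section Quotient

variable {L : Type u} [Order.Frame L]

/-- `s` is saturated for the binary relation `rel` on a frame. -/
def IsSaturated (rel : L → L → Prop) (s : L) : Prop :=
  ∀ a b c : L, rel a b → (a ⊓ c ≤ s ↔ b ⊓ c ≤ s)

/-- The sublocale `L/∼` of `∼`-saturated elements.  The corresponding quotient map `μ_∼` is
`(saturated rel).restrict`, which sends `x` to the least saturated element above `x`. -/
def saturated (rel : L → L → Prop) : Sublocale L where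
  carrier := {s | IsSaturated rel s}
  sInf_mem' S hS a b c hab := by
    simp only [le_sInf_iff]
    exact forall₂_congr fun s hs => hS hs a b c hab
  himp_mem' x s hs a b c hab := by
    simp only [le_himp_iff, inf_assoc]
    exact hs a b (c ⊓ x) hab

theorem restrict_eq_of_rel {rel : L → L → Prop} {a b : L} (h : rel a b) :
    (saturated rel).restrict a = (saturated rel).restrict b := by
  refine eq_of_forall_ge_iff fun s => ?_
  rw [(saturated rel).giRestrict.gc.le_iff_le, (saturated rel).giRestrict.gc.le_iff_le]
  simpa using s.2 a b ⊤ h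

theorem restrict_restrict {S T : Sublocale L} (h : S ≤ T) (x : L) :
    S.restrict (T.restrict x : L) = S.restrict x :=
  le_antisymm
    (S.giRestrict.gc.l_le
      (show T.restrict x ≤ (⟨_, h (S.restrict x).2⟩ : T) from
        T.giRestrict.gc.l_le (S.giRestrict.gc.le_u_l x)))
    (S.giRestrict.gc.monotone_l (T.giRestrict.gc.le_u_l x))

/-- The frame map `T → S` of an inclusion of sublocales `S ⊆ T`. -/
def restrictOfLE {S T : Sublocale L} (h : S ≤ T) : FrameHom T S where
  toFun t := S.restrict (t : L)
  map_inf' a b := by simp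
  map_top' := by
    have := restrict_restrict h ⊤
    rwa [map_top, map_top] at this
  map_sSup' A := by
    have hA : sSup A = T.restrict (sSup (Subtype.val '' A)) := by
      rw [T.giRestrict.gc.l_sSup, sSup_eq_iSup, iSup_image]
      exact iSup_congr fun a => iSup_congr fun _ => (T.giRestrict.l_u_eq a).symm
    rw [hA, restrict_restrict h, map_sSup, Set.image_image]

/-- The sublocale set attached to a frame map `h : L → M`: the fixed points of `h_* h`, where `h_*`
is the right adjoint of `h`. -/
def fixedSublocale {M : Type u} [Order.Frame M] (h : FrameHom L M) : Sublocale L where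
  carrier := {v | ∀ w, h w ≤ h v → w ≤ v}
  sInf_mem' S hS w hw := by
    refine le_sInf fun s hs => hS hs w (hw.trans (OrderHomClass.mono h (sInf_le hs)))
  himp_mem' x s hs w hw := by
    rw [le_himp_iff]
    refine hs _ ?_
    rw [map_inf]
    refine (inf_le_inf_right _ hw).trans ?_
    rw [← map_inf]
    exact OrderHomClass.mono h (by simp)

theorem map_restrict_of_rel {M : Type u} [Order.Frame M] (rel : L → L → Prop)
    (h : FrameHom L M) (hrel : ∀ a b, rel a b → h a = h b) (x : L) :
    h ((saturated rel).restrict x : L) = h x := by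
  refine le_antisymm ?_ (OrderHomClass.mono h ((saturated rel).giRestrict.gc.le_u_l x))
  let t : L := sSup {w | h w ≤ h x}
  have ht : h t ≤ h x := by
    rw [map_sSup]
    exact sSup_le (by rintro _ ⟨w, hw, rfl⟩; exact hw)
  have hle : ∀ w, w ≤ t ↔ h w ≤ h x := fun w =>
    ⟨fun hw => (OrderHomClass.mono h hw).trans ht, fun hw => le_sSup hw⟩
  have hts : t ∈ saturated rel := by
    intro a b c hab
    rw [hle, hle, map_inf, map_inf, hrel a b hab]
  have : ((saturated rel).restrict x) ≤ (⟨t, hts⟩ : saturated rel) := by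
    rw [(saturated rel).giRestrict.gc.le_iff_le]
    exact (hle x).2 le_rfl
  exact (OrderHomClass.mono h (show ((saturated rel).restrict x : L) ≤ t from this)).trans ht

/-- A frame map that equalises `rel` factors through the quotient by `rel`. -/
def saturatedDesc {M : Type u} [Order.Frame M] (rel : L → L → Prop) (h : FrameHom L M)
    (hrel : ∀ a b, rel a b → h a = h b) : FrameHom (saturated rel) M where
  toFun s := h s
  map_inf' a b := by simp
  map_top' := by
    have := map_restrict_of_rel rel h hrel ⊤
    rw [map_top, map_top] at this
    exact this
  map_sSup' S := by
    have hS : sSup S = (saturated rel).restrict (sSup (Subtype.val '' S)) := by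
      rw [(saturated rel).giRestrict.gc.l_sSup, sSup_eq_iSup, iSup_image]
      refine iSup_congr fun a => iSup_congr fun _ => ?_
      exact ((saturated rel).giRestrict.l_u_eq a).symm
    rw [hS, map_restrict_of_rel rel h hrel, map_sSup, Set.image_image]

@[simp] theorem saturatedDesc_restrict {M : Type u} [Order.Frame M] (rel : L → L → Prop)
    (h : FrameHom L M) (hrel : ∀ a b, rel a b → h a = h b) (x : L) :
    saturatedDesc rel h hrel ((saturated rel).restrict x) = h x :=
  map_restrict_of_rel rel h hrel x

end Quotient

/-! ### Coproducts of frames -/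

section Coproduct

theorem mem_of_le_of_le {L M : Type u} [Order.Frame L] [Order.Frame M] {D : LowerSet (L × M)}
    {a a' : L} {b b' : M} (h : (a, b) ∈ D) (ha : a' ≤ a) (hb : b' ≤ b) : (a', b') ∈ D :=
  D.lower (show (a', b') ≤ (a, b) from ⟨ha, hb⟩) h

variable (L M : Type u) [Order.Frame L] [Order.Frame M]

/-- The underlying sublocale set of the frame coproduct: lower sets `D` of `L × M` such that
`D` is closed under joins in each coordinate separately (in particular, under empty joins). -/
def coprodIdeals : Sublocale (LowerSet (L × M)) where
  carrier := {D |
    (∀ (s : Set L) (y : M), (∀ x ∈ s, (x, y) ∈ D) → (sSup s, y) ∈ D) ∧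
    (∀ (x : L) (t : Set M), (∀ y ∈ t, (x, y) ∈ D) → (x, sSup t) ∈ D)}
  sInf_mem' S hS := by
    simp only [Set.mem_ofPred_eq, LowerSet.mem_sInf_iff]
    exact ⟨fun s y h D hD => (hS hD).1 s y fun x hx => h x hx D hD,
      fun x t h D hD => (hS hD).2 x t fun y hy => h y hy D hD⟩
  himp_mem' A D hD := by
    have key : ∀ p : L × M, p ∈ A ⇨ D ↔ ∀ q ≤ p, q ∈ A → q ∈ D := by
      intro p
      rw [← LowerSet.Iic_le, le_himp_iff]
      exact ⟨fun h q hq hA => h ⟨hq, hA⟩, fun h q hq => h q hq.1 hq.2⟩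
    simp only [Set.mem_ofPred_eq, key]
    refine ⟨fun s y h ⟨a, b⟩ hq hA => ?_, fun x t h ⟨a, b⟩ hq hA => ?_⟩
    · obtain ⟨ha, hb⟩ := hq
      have : a = sSup ((fun x => a ⊓ x) '' s) := by
        rw [sSup_image, ← inf_sSup_eq]
        exact (inf_eq_left.2 ha).symm
      rw [this]
      refine hD.1 _ _ ?_
      rintro _ ⟨x, hx, rfl⟩
      exact h x hx _ ⟨inf_le_right, hb⟩ (mem_of_le_of_le hA inf_le_left le_rfl)
    · obtain ⟨ha, hb⟩ := hq
      have : b = sSup ((fun y => b ⊓ y) '' t) := by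
        rw [sSup_image, ← inf_sSup_eq]
        exact (inf_eq_left.2 hb).symm
      rw [this]
      refine hD.2 _ _ ?_
      rintro _ ⟨y, hy, rfl⟩
      exact h y hy _ ⟨ha, inf_le_right⟩ (mem_of_le_of_le hA le_rfl inf_le_left)

/-- The coproduct `L ⊗ M` of frames. -/
abbrev FrameCoprod : Type u := coprodIdeals L M

variable {L M}

/-- The basic rectangle `x ⊗ y`: the least element of `L ⊗ M` that contains the pair `(x, y)`. -/
def rect (x : L) (y : M) : FrameCoprod L M := (coprodIdeals L M).restrict (LowerSet.Iic (x, y))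

theorem rect_le_iff {x : L} {y : M} {D : FrameCoprod L M} :
    rect x y ≤ D ↔ (x, y) ∈ (D : LowerSet (L × M)) := by
  rw [rect, (coprodIdeals L M).giRestrict.gc.le_iff_le, LowerSet.Iic_le]

theorem rect_inf_rect (x x' : L) (y y' : M) :
    rect x y ⊓ rect x' y' = rect (x ⊓ x') (y ⊓ y') := by
  rw [rect, rect, rect, ← map_inf, ← LowerSet.Iic_inf]
  rfl

theorem rect_top_top : rect (⊤ : L) (⊤ : M) = ⊤ :=
  top_le_iff.1 fun _ _ => rect_le_iff.1 le_rfl |> fun h =>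
    (rect (⊤ : L) (⊤ : M)).1.lower ⟨le_top, le_top⟩ h

theorem rect_sSup_left (s : Set L) (y : M) : rect (sSup s) y = ⨆ x ∈ s, rect x y := by
  refine eq_of_forall_ge_iff fun D => ?_
  simp only [iSup_le_iff, rect_le_iff]
  exact ⟨fun h x hx => mem_of_le_of_le h (le_sSup hx) le_rfl, D.2.1 s y⟩

theorem rect_sSup_right (x : L) (t : Set M) : rect x (sSup t) = ⨆ y ∈ t, rect x y := by
  refine eq_of_forall_ge_iff fun D => ?_
  simp only [iSup_le_iff, rect_le_iff]
  exact ⟨fun h y hy => mem_of_le_of_le h le_rfl (le_sSup hy), D.2.2 x t⟩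

theorem eq_iSup_rect (D : FrameCoprod L M) :
    D = ⨆ p ∈ (D : LowerSet (L × M)), rect p.1 p.2 := by
  refine le_antisymm (fun p hp => ?_) (iSup₂_le fun p hp => rect_le_iff.2 hp)
  exact rect_le_iff.1 (le_iSup₂_of_le (f := fun (p : L × M) (_ : p ∈ D.1) => rect p.1 p.2)
    p hp le_rfl)

variable (L M) in
/-- The coproduct injection `x ↦ x ⊗ ⊤`. -/
def inlHom : FrameHom L (FrameCoprod L M) where
  toFun x := rect x ⊤
  map_inf' x x' := by rw [rect_inf_rect, inf_idem]
  map_top' := rect_top_top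
  map_sSup' s := by rw [rect_sSup_left, sSup_image]

variable (L M) in
/-- The coproduct injection `y ↦ ⊤ ⊗ y`. -/
def inrHom : FrameHom M (FrameCoprod L M) where
  toFun y := rect ⊤ y
  map_inf' y y' := by rw [rect_inf_rect, inf_idem]
  map_top' := rect_top_top
  map_sSup' s := by rw [rect_sSup_right, sSup_image]

theorem rect_eq (x : L) (y : M) : rect x y = inlHom L M x ⊓ inrHom L M y := by
  change _ = rect x ⊤ ⊓ rect ⊤ y
  rw [rect_inf_rect, inf_top_eq, top_inf_eq]

variable {N : Type u} [Order.Frame N]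

/-- The upper adjoint of the copairing `[h, k] : L ⊗ M → N`. -/
def copairAdj (h : FrameHom L N) (k : FrameHom M N) (n : N) : FrameCoprod L M :=
  ⟨⟨{p | h p.1 ⊓ k p.2 ≤ n}, fun _ _ hpq hp =>
      (inf_le_inf (OrderHomClass.mono h hpq.1) (OrderHomClass.mono k hpq.2)).trans hp⟩,
    fun s y hs => by
      change h (sSup s) ⊓ k y ≤ n
      rw [map_sSup, sSup_inf_eq, iSup₂_le_iff]
      rintro _ ⟨x, hx, rfl⟩
      exact hs x hx,
    fun x t ht => by
      change h x ⊓ k (sSup t) ≤ n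
      rw [map_sSup, inf_sSup_eq, iSup₂_le_iff]
      rintro _ ⟨y, hy, rfl⟩
      exact ht y hy⟩

/-- The copairing `[h, k] : L ⊗ M → N`. -/
def copair (h : FrameHom L N) (k : FrameHom M N) : FrameHom (FrameCoprod L M) N :=
  have gc : GaloisConnection
      (fun D : FrameCoprod L M => ⨆ p ∈ (D : LowerSet (L × M)), h p.1 ⊓ k p.2)
      (copairAdj h k) := fun D n => by
    simp only [iSup_le_iff]
    rfl
  { toFun := fun D => ⨆ p ∈ (D : LowerSet (L × M)), h p.1 ⊓ k p.2
    map_inf' := fun D E => by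
      refine le_antisymm (le_inf (gc.monotone_l inf_le_left) (gc.monotone_l inf_le_right)) ?_
      simp only [iSup_inf_eq, inf_iSup_eq, iSup_le_iff]
      intro p hp q hq
      refine le_iSup₂_of_le (p ⊓ q)
        ⟨D.1.lower inf_le_right hq, E.1.lower inf_le_left hp⟩ ?_
      rw [inf_comm (h q.1 ⊓ k q.2), Prod.fst_inf, Prod.snd_inf, map_inf, map_inf, inf_inf_inf_comm]
    map_top' := top_le_iff.1 (le_iSup₂_of_le (⊤, ⊤) trivial (by simp))
    map_sSup' := fun S => by
      rw [gc.l_sSup, sSup_image] }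

@[simp] theorem copair_rect (h : FrameHom L N) (k : FrameHom M N) (x : L) (y : M) :
    copair h k (rect x y) = h x ⊓ k y := by
  refine eq_of_forall_ge_iff fun n => ?_
  refine Iff.trans (b := rect x y ≤ copairAdj h k n) ?_ rect_le_iff
  change (⨆ p ∈ (rect x y : LowerSet (L × M)), h p.1 ⊓ k p.2) ≤ n ↔ _
  simp only [iSup_le_iff]
  rfl

theorem hom_ext {f g : FrameHom (FrameCoprod L M) N}
    (h1 : ∀ x, f (inlHom L M x) = g (inlHom L M x))
    (h2 : ∀ y, f (inrHom L M y) = g (inrHom L M y)) : f = g := by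
  ext D
  rw [eq_iSup_rect D]
  simp only [map_iSup, rect_eq, map_inf, h1, h2]

end Coproduct

/-! ### Limits and colimits of locales -/

section Category

/-- The frame map `f⁻¹ : 𝒪 Y → 𝒪 X` of a locale map `f : X → Y`. -/
def preimage {X Y : Locale.{u}} (f : X ⟶ Y) : FrameHom Y X :=
  (Quiver.Hom.unop (V := Frm.{u}) f).hom

/-- The locale map with a given frame map. -/
def mkHom {X Y : Locale.{u}} (h : FrameHom Y X) : X ⟶ Y :=
  Quiver.Hom.op (V := Frm.{u}) (Frm.ofHom h)

@[simp] theorem preimage_mkHom {X Y : Locale.{u}} (h : FrameHom Y X) :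
    preimage (mkHom h) = h := rfl

@[simp] theorem preimage_id (X : Locale.{u}) : preimage (𝟙 X) = FrameHom.id X := rfl

@[simp] theorem preimage_comp {X Y Z : Locale.{u}} (f : X ⟶ Y) (g : Y ⟶ Z) :
    preimage (f ≫ g) = (preimage f).comp (preimage g) := rfl

theorem preimage_comp_apply {X Y Z : Locale.{u}} (f : X ⟶ Y) (g : Y ⟶ Z) (z : Z) :
    preimage (f ≫ g) z = preimage f (preimage g z) := rfl

theorem locale_hom_ext {X Y : Locale.{u}} {f g : X ⟶ Y}
    (h : ∀ y, preimage f y = preimage g y) : f = g :=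
  Quiver.Hom.unop_inj (Frm.hom_ext (FrameHom.ext h))

/-- The product of two locales: its frame of opens is the frame coproduct. -/
def prodLoc (X Y : Locale.{u}) : Locale.{u} := Locale.of (FrameCoprod X Y)

/-- The first projection; `pr₁⁻¹(U) = U ⊗ ⊤`. -/
def pr₁ (X Y : Locale.{u}) : prodLoc X Y ⟶ X := mkHom (inlHom X Y)

/-- The second projection; `pr₂⁻¹(V) = ⊤ ⊗ V`. -/
def pr₂ (X Y : Locale.{u}) : prodLoc X Y ⟶ Y := mkHom (inrHom X Y)

/-- The pairing `(f, g) : Z → X × Y`. -/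
def pair {X Y Z : Locale.{u}} (f : Z ⟶ X) (g : Z ⟶ Y) : Z ⟶ prodLoc X Y :=
  mkHom (Y := prodLoc X Y) (copair (preimage f) (preimage g))

theorem preimage_pair_rect {X Y Z : Locale.{u}} (f : Z ⟶ X) (g : Z ⟶ Y) (U : X) (V : Y) :
    preimage (pair f g) (rect U V : FrameCoprod X Y) = preimage f U ⊓ preimage g V :=
  copair_rect _ _ U V

@[simp] theorem pair_pr₁ {X Y Z : Locale.{u}} (f : Z ⟶ X) (g : Z ⟶ Y) :
    pair f g ≫ pr₁ X Y = f :=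
  locale_hom_ext fun U => (preimage_pair_rect f g U ⊤).trans (by simp)

@[simp] theorem pair_pr₂ {X Y Z : Locale.{u}} (f : Z ⟶ X) (g : Z ⟶ Y) :
    pair f g ≫ pr₂ X Y = g :=
  locale_hom_ext fun V => (preimage_pair_rect f g ⊤ V).trans (by simp)

theorem prod_hom_ext {X Y Z : Locale.{u}} {f g : Z ⟶ prodLoc X Y}
    (h1 : f ≫ pr₁ X Y = g ≫ pr₁ X Y) (h2 : f ≫ pr₂ X Y = g ≫ pr₂ X Y) : f = g :=
  locale_hom_ext fun D => DFunLike.congr_fun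
    (hom_ext (f := preimage f) (g := preimage g)
      (fun x => DFunLike.congr_fun (congrArg preimage h1) x)
      (fun y => DFunLike.congr_fun (congrArg preimage h2) y)) D

/-- `X × Y` is the categorical product. -/
def prodLocIsLimit (X Y : Locale.{u}) : IsLimit (BinaryFan.mk (pr₁ X Y) (pr₂ X Y)) :=
  BinaryFan.isLimitMk (fun s => pair s.fst s.snd) (fun _ => pair_pr₁ _ _)
    (fun _ => pair_pr₂ _ _) (fun _ _ h1 h2 => prod_hom_ext
      (h1.trans (pair_pr₁ _ _).symm) (h2.trans (pair_pr₂ _ _).symm))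

instance : HasBinaryProducts Locale.{u} :=
  have (X Y : Locale.{u}) : HasLimit (Limits.pair X Y) := ⟨⟨⟨_, prodLocIsLimit X Y⟩⟩⟩
  hasBinaryProducts_of_hasLimit_pair _

/-- A sublocale of `X`, as a locale in its own right. -/
def subLoc {X : Locale.{u}} (S : Sublocale X) : Locale.{u} := Locale.of S

/-- The inclusion map of a sublocale. -/
def incl {X : Locale.{u}} (S : Sublocale X) : subLoc S ⟶ X := mkHom (X := subLoc S) S.restrict

theorem preimage_incl_surjective {X : Locale.{u}} (S : Sublocale X) :
    Function.Surjective (preimage (incl S)) := S.giRestrict.l_surjective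

instance {X Y : Locale.{u}} (f g : X ⟶ Y) : HasLimit (parallelPair f g) := by
  let rel : X → X → Prop := fun a b => ∃ v : Y, a = preimage f v ∧ b = preimage g v
  have w : incl (saturated rel) ≫ f = incl (saturated rel) ≫ g :=
    locale_hom_ext fun v => restrict_eq_of_rel ⟨v, rfl, rfl⟩
  have hs (s : Fork f g) : ∀ a b, rel a b → preimage s.ι a = preimage s.ι b := by
    rintro _ _ ⟨v, rfl, rfl⟩
    exact DFunLike.congr_fun (congrArg preimage s.condition) v
  exact ⟨⟨⟨Fork.ofι _ w, Fork.IsLimit.mk _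
    (fun s => mkHom (Y := subLoc (saturated rel)) (saturatedDesc rel (preimage s.ι) (hs s)))
    (fun s => locale_hom_ext fun x => saturatedDesc_restrict rel _ (hs s) x)
    (fun s m hm => locale_hom_ext fun x => by
      obtain ⟨x, rfl⟩ := preimage_incl_surjective _ x
      refine (DFunLike.congr_fun (congrArg preimage hm) x).trans ?_
      exact (saturatedDesc_restrict rel _ (hs s) x).symm)⟩⟩⟩

instance : HasEqualizers Locale.{u} := hasEqualizers_of_hasLimit_parallelPair _

instance : HasPullbacks Locale.{u} := hasPullbacks_of_hasBinaryProducts_of_hasEqualizers _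

end Category

section Subframe

variable {L M : Type u} [Order.Frame L] [Order.Frame M]

/-- The subframe `{x | f x = g x}` on which two frame maps agree. -/
structure EqFrame (f g : FrameHom L M) : Type u where
  /-- The underlying element. -/
  val : L
  eq : f val = g val

namespace EqFrame

variable (f g : FrameHom L M)

theorem val_injective : Function.Injective (val : EqFrame f g → L)
  | ⟨_, _⟩, ⟨_, _⟩, rfl => rfl

instance : PartialOrder (EqFrame f g) := PartialOrder.lift val (val_injective f g)

instance : SemilatticeInf (EqFrame f g) where
  inf a b := ⟨a.1 ⊓ b.1, by rw [map_inf, map_inf, a.2, b.2]⟩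
  inf_le_left a b := show a.1 ⊓ b.1 ≤ a.1 from inf_le_left
  inf_le_right a b := show a.1 ⊓ b.1 ≤ b.1 from inf_le_right
  le_inf a b c h1 h2 := show a.1 ≤ b.1 ⊓ c.1 from le_inf h1 h2

instance : SupSet (EqFrame f g) where
  sSup S := ⟨sSup (val '' S), by
    rw [map_sSup, map_sSup, Set.image_image, Set.image_image]
    exact congrArg sSup (Set.image_congr fun a _ => a.2)⟩

theorem isLUB_sSup' (S : Set (EqFrame f g)) : IsLUB S (sSup S) :=
  ⟨fun a ha => show a.1 ≤ sSup (val '' S) from le_sSup ⟨a, ha, rfl⟩,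
    fun b hb => show sSup (val '' S) ≤ b.1 from
      sSup_le (by rintro _ ⟨a, ha, rfl⟩; exact hb ha)⟩

instance : CompleteLattice (EqFrame f g) where
  __ := (inferInstance : SemilatticeInf (EqFrame f g))
  __ := completeLatticeOfSup (EqFrame f g) (isLUB_sSup' f g)

instance : Order.Frame (EqFrame f g) := .ofMinimalAxioms
  { inf_sSup_le_iSup_inf := fun a S => by
      change a.1 ⊓ sSup (val '' S) ≤ (⨆ b ∈ S, a ⊓ b : EqFrame f g).1
      rw [inf_sSup_eq, iSup₂_le_iff]
      rintro _ ⟨b, hb, rfl⟩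
      exact le_iSup₂ (f := fun (b : EqFrame f g) (_ : b ∈ S) => a ⊓ b) b hb }

/-- The inclusion of the subframe. -/
def valHom : FrameHom (EqFrame f g) L where
  toFun := val
  map_inf' _ _ := rfl
  map_top' := top_le_iff.1 (show (⊤ : L) ≤ (⊤ : EqFrame f g).1 from
    le_top (a := (⟨⊤, by simp⟩ : EqFrame f g)))
  map_sSup' _ := rfl

/-- The universal property of the subframe. -/
def lift {N : Type u} [Order.Frame N] (h : FrameHom N L) (w : ∀ x, f (h x) = g (h x)) :
    FrameHom N (EqFrame f g) where
  toFun x := ⟨h x, w x⟩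
  map_inf' a b := val_injective f g (map_inf h a b)
  map_top' := val_injective f g ((map_top h).trans (map_top (valHom f g)).symm)
  map_sSup' S := val_injective f g ((map_sSup h S).trans (by
    change _ = sSup (val '' _)
    rw [Set.image_image]))

end EqFrame

instance {X Y : Locale.{u}} (f g : X ⟶ Y) : HasColimit (parallelPair f g) := by
  have w : f ≫ mkHom (Y := Locale.of (EqFrame (preimage f) (preimage g))) (EqFrame.valHom _ _) =
      g ≫ mkHom (Y := Locale.of (EqFrame (preimage f) (preimage g))) (EqFrame.valHom _ _) :=
    locale_hom_ext fun v => v.eq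
  exact ⟨⟨⟨Cofork.ofπ _ w, Cofork.IsColimit.mk _
    (fun s => mkHom (X := Locale.of (EqFrame (preimage f) (preimage g)))
      (EqFrame.lift _ _ (preimage s.π) (DFunLike.congr_fun (congrArg preimage s.condition))))
    (fun _ => rfl)
    (fun s m hm => locale_hom_ext fun x =>
      EqFrame.val_injective _ _ (DFunLike.congr_fun (congrArg preimage hm) x))⟩⟩⟩

instance : HasCoequalizers Locale.{u} := hasCoequalizers_of_hasColimit_parallelPair _

end Subframe

/-! ### Localic relations -/

section Relations

/-- The image sublocale of a locale map, as a sublocale set: the fixed points of `f_* f⁻¹`. -/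
def image {X Y : Locale.{u}} (f : X ⟶ Y) : Sublocale Y := fixedSublocale (preimage f)

/-- The locale map `S → T` underlying an inclusion `S ⊆ T` of sublocales. -/
def inclOfLE {X : Locale.{u}} {S T : Sublocale X} (h : S ≤ T) : subLoc S ⟶ subLoc T :=
  mkHom (X := subLoc S) (Y := subLoc T) (restrictOfLE h)

theorem inclOfLE_incl {X : Locale.{u}} {S T : Sublocale X} (h : S ≤ T) :
    inclOfLE h ≫ incl T = incl S :=
  locale_hom_ext fun x => restrict_restrict h x

/-- A localic relation on `X` is a sublocale of `X × X`. -/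
abbrev LocalicRelation (X : Locale.{u}) : Type u := Sublocale (prodLoc X X)

variable {X : Locale.{u}}

/-- The source map `pr₁ ∘ r` of a relation `r : R ↣ X × X`. -/
def source (R : LocalicRelation X) : subLoc R ⟶ X := incl R ≫ pr₁ X X

/-- The target map `pr₂ ∘ r` of a relation `r : R ↣ X × X`. -/
def target (R : LocalicRelation X) : subLoc R ⟶ X := incl R ≫ pr₂ X X

/-- The diagonal relation. -/
def diagonal (X : Locale.{u}) : LocalicRelation X := image (pair (𝟙 X) (𝟙 X))

/-- The opposite relation, with source and target interchanged. -/
def opposite (R : LocalicRelation X) : LocalicRelation X := image (pair (target R) (source R))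

/-- The composite `R ∘ Q` (first `R`, then `Q`): the image in `X × X` of the pullback of the target
map of `R` along the source map of `Q`. -/
noncomputable def composite (R Q : LocalicRelation X) : LocalicRelation X :=
  image (pair (pullback.fst (target R) (source Q) ≫ source R)
    (pullback.snd (target R) (source Q) ≫ target Q))

/-- Localic equivalence relations: reflexive, symmetric and transitive. -/
structure IsEquivalence (R : LocalicRelation X) : Prop where
  refl : diagonal X ≤ R
  symm : R = opposite R
  trans : composite R R ≤ R

/-- Open maps of locales: `f⁻¹` has a left adjoint that satisfies Frobenius reciprocity. -/
def IsOpenMap {X Y : Locale.{u}} (f : X ⟶ Y) : Prop :=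
  ∃ l : X → Y, GaloisConnection l (preimage f) ∧
    ∀ (U : X) (V : Y), l (U ⊓ preimage f V) = l U ⊓ V

/-- The map `f_!`, given by the formula for the left adjoint of `f⁻¹`. -/
def shriek {X Y : Locale.{u}} (f : X ⟶ Y) (U : X) : Y := sInf {V | U ≤ preimage f V}

theorem shriek_eq {X Y : Locale.{u}} {f : X ⟶ Y} {l : X → Y}
    (h : GaloisConnection l (preimage f)) : shriek f = l :=
  funext fun U => le_antisymm (sInf_le (h.le_u_l U)) (le_sInf fun _ hV => h.l_le hV)

theorem IsOpenMap.gc {X Y : Locale.{u}} {f : X ⟶ Y} (hf : IsOpenMap f) :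
    GaloisConnection (shriek f) (preimage f) := by
  obtain ⟨l, hl, -⟩ := hf
  rwa [shriek_eq hl]

theorem IsOpenMap.frobenius {X Y : Locale.{u}} {f : X ⟶ Y} (hf : IsOpenMap f) (U : X) (V : Y) :
    shriek f (U ⊓ preimage f V) = shriek f U ⊓ V := by
  obtain ⟨l, hl, h⟩ := hf
  rw [shriek_eq hl, h]

/-- A relation has open cones if its source and target maps are open. -/
structure HasOpenCones (R : LocalicRelation X) : Prop where
  source : IsOpenMap (source R)
  target : IsOpenMap (target R)

/-- The up cone `t_! s⁻¹`. -/
def upCone (R : LocalicRelation X) (U : X) : X := shriek (target R) (preimage (source R) U)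

/-- The down cone `s_! t⁻¹`. -/
def downCone (R : LocalicRelation X) (U : X) : X := shriek (source R) (preimage (target R) U)

/-- The relation `∼` on rectangles of `𝒪 X ⊗ 𝒪 X` induced by cones `up`, `down`:
`A ⊗ B ∼ C ⊗ D` iff `up A ∧ B = up C ∧ D` and `A ∧ down B = C ∧ down D`. -/
def coneRel (up down : X → X) (u v : FrameCoprod X X) : Prop :=
  ∃ A B C D : X, u = rect A B ∧ v = rect C D ∧
    up A ⊓ B = up C ⊓ D ∧ A ⊓ down B = C ⊓ down D

/-- The localic relation induced by a pair of cones: the sublocale `(𝒪 X ⊗ 𝒪 X)/∼`. -/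
def inducedRelation (up down : X → X) : LocalicRelation X :=
  saturated (L := FrameCoprod X X) (coneRel up down)

/-- The relation `R_{↑↓}` induced by the cones of `R`. -/
def upDown (R : LocalicRelation X) : LocalicRelation X :=
  inducedRelation (upCone R) (downCone R)

/-- The quotient map `X → X/R`: the coequaliser of the source and target maps of `R`. -/
noncomputable def quotientMap (R : LocalicRelation X) :
    X ⟶ coequalizer (source R) (target R) := coequalizer.π (source R) (target R)

/-- The kernel pair `X ×_Q X` of a locale map `q : X → Q`. -/
noncomputable abbrev kernelPair {Q : Locale.{u}} (q : X ⟶ Q) : Locale.{u} := pullback q q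

/-- The canonical map `X ×_Q X → X × X`. -/
noncomputable def kernelPairMap {Q : Locale.{u}} (q : X ⟶ Q) : kernelPair q ⟶ prodLoc X X :=
  pair (pullback.fst q q) (pullback.snd q q)

/-- Kock's inclusion of `R` into its kernel pair `X ×_{X/R} X`: the map induced by the source and
target maps of `R`. -/
noncomputable def kockInclusion (R : LocalicRelation X) :
    subLoc R ⟶ kernelPair (quotientMap R) :=
  pullback.lift (source R) (target R) (coequalizer.condition (source R) (target R))

theorem kockInclusion_kernelPairMap (R : LocalicRelation X) :
    kockInclusion R ≫ kernelPairMap (quotientMap R) = incl R := by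
  refine prod_hom_ext ?_ ?_
  · rw [kernelPairMap, Category.assoc, pair_pr₁]
    exact pullback.lift_fst _ _ _
  · rw [kernelPairMap, Category.assoc, pair_pr₂]
    exact pullback.lift_snd _ _ _

end Relations

end LocalicRel

/-!
Write `s`, `t` for the source and target maps of `R` and `q : X → X/R` for their coequaliser; the
opens of `X/R` are the opens `V` of `X` with `s⁻¹V = t⁻¹V`. Since `t` is open, the Beck–Chevalley
identity `s⁻¹ t_! = π₂_! π₁⁻¹` for the pullback `R ×_X R` turns transitivity into the statement that
`↑U` is such an open. Reflexivity makes it the least one above `U`, so `q⁻¹` has a left adjoint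
`q_!` with `↑ = q⁻¹ q_!`, and symmetry gives `↓ = ↑`.

Whenever `q⁻¹` has a left adjoint, the cones `q⁻¹ q_!` induce the kernel pair of `q`. Indeed, if
`q a = q b`, then `a⁻¹A ≤ a⁻¹(q⁻¹ q_! A) = b⁻¹(q⁻¹ q_! A)`, and symmetrically for `b⁻¹B`, so
`(a, b)⁻¹` identifies `A ⊗ B` with `(A ∧ ↓B) ⊗ (↑A ∧ B)` and hence respects the generators of `∼`.
Conversely `q⁻¹W ⊗ ⊤ ∼ ⊤ ⊗ q⁻¹W`, so the two projections of the induced relation agree after `q`.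
-/

namespace LocalicRel

section Sublocales

theorem restrict_le_mk_iff {L : Type u} [Order.Frame L] {S : Sublocale L} {x v : L} (hv : v ∈ S) :
    S.restrict x ≤ ⟨v, hv⟩ ↔ x ≤ v :=
  S.giRestrict.gc.le_iff_le

theorem fixedSublocale_eq_saturated {L M : Type u} [Order.Frame L] [Order.Frame M]
    (h : FrameHom L M) : fixedSublocale h = saturated fun a b => h a = h b := by
  ext v
  constructor
  · intro hv
    have le_iff (x : L) : x ≤ v ↔ h x ≤ h v := ⟨fun hx => OrderHomClass.mono h hx, hv x⟩
    intro a b c hab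
    rw [le_iff, le_iff, map_inf, map_inf, hab]
  · intro hv w hw
    have hsup : h (w ⊔ v) = h v := by rw [map_sup, sup_eq_right.2 hw]
    have : w ⊔ v ≤ v := by simpa using hv (w ⊔ v) v ⊤ hsup
    exact le_sup_left.trans this

variable {X Z : Locale.{u}}

instance mono_incl (S : Sublocale X) : Mono (incl S) where
  right_cancellation _ _ h := locale_hom_ext fun v => by
    obtain ⟨x, rfl⟩ := preimage_incl_surjective S v
    exact DFunLike.congr_fun (congrArg preimage h) x

theorem exists_comp_incl_saturated {rel : X → X → Prop} (f : Z ⟶ X)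
    (hrel : ∀ a b, rel a b → preimage f a = preimage f b) :
    ∃ g : Z ⟶ subLoc (saturated rel), g ≫ incl (saturated rel) = f :=
  ⟨mkHom (Y := subLoc (saturated rel)) (saturatedDesc rel (preimage f) hrel),
    locale_hom_ext (saturatedDesc_restrict rel (preimage f) hrel)⟩

theorem image_le_iff {f : Z ⟶ X} {S : Sublocale X} :
    image f ≤ S ↔ ∃ g : Z ⟶ subLoc S, g ≫ incl S = f := by
  constructor
  · rw [image, fixedSublocale_eq_saturated]
    intro hS
    obtain ⟨g, hg⟩ := exists_comp_incl_saturated f fun _ _ hab => hab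
    exact ⟨g ≫ inclOfLE hS, by rw [Category.assoc, inclOfLE_incl, hg]⟩
  · rintro ⟨g, rfl⟩ v hv
    have hle : (S.restrict v : X) ≤ v :=
      hv _ (OrderHomClass.mono (preimage g) (S.giRestrict.gc.l_u_l_eq_l v).le)
    exact hle.antisymm (S.giRestrict.gc.le_u_l v) ▸ (S.restrict v).2

theorem image_incl (S : Sublocale X) : image (incl S) = S := by
  refine le_antisymm (image_le_iff.2 ⟨𝟙 _, Category.id_comp _⟩) fun v hv w hw => ?_
  exact (restrict_le_mk_iff hv).1 (hw.trans ((restrict_le_mk_iff hv).2 le_rfl))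

end Sublocales

section BeckChevalley

variable {L M : Type u} [Order.Frame L] [Order.Frame M]

/-- The ideal of those `(a, b)` with `φ a ⊓ b ≤ c`. As a function of `c` this is right adjoint to
the join-preserving map `L ⊗ M → M` that sends `a ⊗ b` to `φ a ⊓ b`; when `φ` comes from an open
map, that map is the left adjoint along the projection of a pullback. -/
def infLEIdeal (φ : sSupHom L M) (c : M) : FrameCoprod L M :=
  ⟨⟨{p | φ p.1 ⊓ p.2 ≤ c}, fun _ _ hpq hp =>
      (inf_le_inf (OrderHomClass.mono φ hpq.1) hpq.2).trans hp⟩,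
    fun s y hs => by
      change φ (sSup s) ⊓ y ≤ c
      rw [map_sSup, sSup_inf_eq, iSup₂_le_iff]
      rintro _ ⟨x, hx, rfl⟩
      exact hs x hx,
    fun x t ht => by
      change φ x ⊓ sSup t ≤ c
      rw [inf_sSup_eq, iSup₂_le_iff]
      exact ht⟩

theorem rect_le_infLEIdeal_iff {φ : sSupHom L M} {a : L} {b c : M} :
    rect a b ≤ infLEIdeal φ c ↔ φ a ⊓ b ≤ c :=
  rect_le_iff

/-- The relation `f⁻¹V ⊗ ⊤ ∼ ⊤ ⊗ g⁻¹V` on `𝒪 A ⊗ 𝒪 B`, whose quotient is the frame of opens of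
the pullback of `f` and `g`. -/
def pullbackRel {A B Z : Locale.{u}} (f : A ⟶ Z) (g : B ⟶ Z) (u v : FrameCoprod A B) : Prop :=
  ∃ V : Z, u = rect (preimage f V) ⊤ ∧ v = rect ⊤ (preimage g V)

variable {A B P Z : Locale.{u}} {f : A ⟶ Z} {g : B ⟶ Z}

theorem infLEIdeal_mem_saturated_pullbackRel {φ : sSupHom A B}
    (hφ : ∀ a V, φ (a ⊓ preimage f V) = φ a ⊓ preimage g V) (c : B) :
    infLEIdeal φ c ∈ saturated (pullbackRel f g) := by
  rintro _ _ D ⟨V, rfl, rfl⟩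
  rw [eq_iSup_rect D]
  simp only [inf_iSup_eq, iSup_le_iff, rect_inf_rect, rect_le_infLEIdeal_iff, top_inf_eq]
  refine forall₂_congr fun p _ => ?_
  rw [inf_comm (preimage f V), hφ, inf_assoc]

theorem incl_saturated_pullbackRel_condition (f : A ⟶ Z) (g : B ⟶ Z) :
    (incl (X := prodLoc A B) (saturated (pullbackRel f g)) ≫ pr₁ A B) ≫ f =
      (incl (X := prodLoc A B) (saturated (pullbackRel f g)) ≫ pr₂ A B) ≫ g :=
  locale_hom_ext fun V => restrict_eq_of_rel (rel := pullbackRel f g) ⟨V, rfl, rfl⟩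

/-- Beck–Chevalley, `snd_! fst⁻¹ = g⁻¹ f_!`, with the left adjoint `snd_!` transposed away. -/
theorem preimage_fst_le_preimage_snd_iff {fst : P ⟶ A} {snd : P ⟶ B}
    (sq : IsPullback fst snd f g) (hf : IsOpenMap f) {a : A} {c : B} :
    preimage fst a ≤ preimage snd c ↔ preimage g (shriek f a) ≤ c := by
  constructor
  · intro h
    let φ : sSupHom A B :=
      { toFun := fun a => preimage g (shriek f a)
        map_sSup' := fun s => by simp only [hf.gc.l_sSup, map_iSup, sSup_image] }
    have hφ (a : A) (V : Z) : φ (a ⊓ preimage f V) = φ a ⊓ preimage g V :=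
      (congrArg (preimage g) (hf.frobenius a V)).trans (map_inf _ _ _)
    let S : Sublocale (FrameCoprod A B) := saturated (pullbackRel f g)
    have hS : infLEIdeal φ c ∈ S := infLEIdeal_mem_saturated_pullbackRel hφ c
    have w := incl_saturated_pullbackRel_condition f g
    have h_restrict : S.restrict (rect a ⊤) ≤ S.restrict (rect ⊤ c) := by
      have := OrderHomClass.mono (preimage (sq.lift _ _ w)) h
      rwa [← preimage_comp_apply, ← preimage_comp_apply, sq.lift_fst, sq.lift_snd] at this
    have hc : S.restrict (rect ⊤ c) ≤ ⟨_, hS⟩ :=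
      (restrict_le_mk_iff hS).2 (rect_le_infLEIdeal_iff.2 inf_le_right)
    have ha : rect a ⊤ ≤ infLEIdeal φ c := (restrict_le_mk_iff hS).1 (h_restrict.trans hc)
    exact inf_top_eq (φ a) ▸ rect_le_infLEIdeal_iff.1 ha
  · intro h
    calc preimage fst a ≤ preimage fst (preimage f (shriek f a)) :=
          OrderHomClass.mono _ (hf.gc.le_u_l a)
      _ = preimage snd (preimage g (shriek f a)) := by
          rw [← preimage_comp_apply, sq.w, preimage_comp_apply]
      _ ≤ preimage snd c := OrderHomClass.mono _ h

end BeckChevalley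

section Coequalizer

variable {X Y : Locale.{u}}

/-- The locale whose opens are the `V` with `f⁻¹V = g⁻¹V`: a concrete model of the coequaliser of
`f` and `g`, used to read off the opens of the abstract one. -/
def eqLoc (f g : Y ⟶ X) : Locale.{u} := Locale.of (EqFrame (preimage f) (preimage g))

/-- The quotient map onto `eqLoc f g`. -/
def eqLocπ (f g : Y ⟶ X) : X ⟶ eqLoc f g := mkHom (Y := eqLoc f g) (EqFrame.valHom _ _)

variable {f g : Y ⟶ X}

theorem eqLocπ_condition : f ≫ eqLocπ f g = g ≫ eqLocπ f g :=
  locale_hom_ext fun v => EqFrame.eq v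

theorem exists_preimage_coequalizer_π_eq {V : X} (hV : preimage f V = preimage g V) :
    ∃ W, preimage (coequalizer.π f g) W = V :=
  ⟨preimage (coequalizer.desc (eqLocπ f g) eqLocπ_condition) (⟨V, hV⟩ : EqFrame _ _),
    DFunLike.congr_fun (congrArg preimage (coequalizer.π_desc _ eqLocπ_condition)) _⟩

theorem preimage_coequalizer_π_condition (W : (coequalizer f g : Locale.{u})) :
    preimage f (preimage (coequalizer.π f g) W) = preimage g (preimage (coequalizer.π f g) W) :=
  DFunLike.congr_fun (congrArg preimage (coequalizer.condition f g)) W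

theorem preimage_coequalizer_π_le_iff {V W : (coequalizer f g : Locale.{u})} :
    preimage (coequalizer.π f g) V ≤ preimage (coequalizer.π f g) W ↔ V ≤ W := by
  refine ⟨fun h => ?_, fun h => OrderHomClass.mono _ h⟩
  let d : coequalizer f g ⟶ eqLoc f g := coequalizer.desc (eqLocπ f g) eqLocπ_condition
  let r : eqLoc f g ⟶ coequalizer f g :=
    mkHom (X := eqLoc f g) (EqFrame.lift _ _ _ preimage_coequalizer_π_condition)
  have hdr : d ≫ r = 𝟙 _ := coequalizer.hom_ext <| by
    rw [← Category.assoc, coequalizer.π_desc, Category.comp_id]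
    rfl
  have h' : preimage r V ≤ preimage r W := h
  have := OrderHomClass.mono (preimage d) h'
  rwa [← preimage_comp_apply, ← preimage_comp_apply, hdr] at this

end Coequalizer

section KernelPair

variable {X Q Z : Locale.{u}}

theorem image_pair_le_iff {R : LocalicRelation X} {a b : Z ⟶ X} :
    image (pair a b) ≤ R ↔ ∃ k : Z ⟶ subLoc R, k ≫ source R = a ∧ k ≫ target R = b := by
  rw [image_le_iff]
  refine exists_congr fun k => ⟨fun h => ⟨?_, ?_⟩, fun h => prod_hom_ext ?_ ?_⟩
  · rw [source, ← Category.assoc, h, pair_pr₁]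
  · rw [target, ← Category.assoc, h, pair_pr₂]
  · rw [Category.assoc, pair_pr₁, ← h.1, source]
  · rw [Category.assoc, pair_pr₂, ← h.2, target]

theorem localicRelation_hom_ext {R : LocalicRelation X} {h k : Z ⟶ subLoc R}
    (hs : h ≫ source R = k ≫ source R) (ht : h ≫ target R = k ≫ target R) : h = k := by
  rw [← cancel_mono (incl R)]
  exact prod_hom_ext hs ht

theorem pair_source_target (R : LocalicRelation X) : pair (source R) (target R) = incl R :=
  prod_hom_ext (pair_pr₁ _ _) (pair_pr₂ _ _)

instance mono_kernelPairMap (q : X ⟶ Q) : Mono (kernelPairMap q) where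
  right_cancellation h k w := by
    have hfst : kernelPairMap q ≫ pr₁ X X = pullback.fst q q := pair_pr₁ _ _
    have hsnd : kernelPairMap q ≫ pr₂ X X = pullback.snd q q := pair_pr₂ _ _
    refine pullback.hom_ext ?_ ?_
    · rw [← hfst, ← Category.assoc, w, Category.assoc]
    · rw [← hsnd, ← Category.assoc, w, Category.assoc]

variable {q : X ⟶ Q}

theorem isKernelPair_source_target_iff {T : LocalicRelation X} :
    IsKernelPair q (source T) (target T) ↔ source T ≫ q = target T ≫ q ∧
      ∀ ⦃Z : Locale.{u}⦄ (a b : Z ⟶ X), a ≫ q = b ≫ q → image (pair a b) ≤ T := by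
  constructor
  · exact fun hT => ⟨hT.w, fun Z a b hab =>
      image_pair_le_iff.2 ⟨hT.lift a b hab, hT.lift_fst a b hab, hT.lift_snd a b hab⟩⟩
  · rintro ⟨w, himage⟩
    choose lift lift_source lift_target using
      fun c : PullbackCone q q => image_pair_le_iff.1 (himage c.fst c.snd c.condition)
    exact ⟨⟨w⟩, ⟨PullbackCone.IsLimit.mk w lift lift_source lift_target fun c m hs ht =>
      localicRelation_hom_ext (hs.trans (lift_source c).symm) (ht.trans (lift_target c).symm)⟩⟩

theorem le_of_isKernelPair {R T : LocalicRelation X} (hT : IsKernelPair q (source T) (target T))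
    (hR : source R ≫ q = target R ≫ q) : R ≤ T := by
  rw [← image_incl R, ← pair_source_target]
  exact (isKernelPair_source_target_iff.1 hT).2 _ _ hR

theorem isoPullback_hom_comp_kernelPairMap {T : LocalicRelation X}
    (hT : IsKernelPair q (source T) (target T)) :
    hT.isoPullback.hom ≫ kernelPairMap q = incl T := by
  refine prod_hom_ext ?_ ?_
  · rw [Category.assoc, kernelPairMap, pair_pr₁, hT.isoPullback_hom_fst, source]
  · rw [Category.assoc, kernelPairMap, pair_pr₂, hT.isoPullback_hom_snd, target]

variable {l : X → Q} (gc : GaloisConnection l (preimage q))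
include gc

theorem preimage_pair_rect_eq_of_comp_eq {a b : Z ⟶ X} (hab : a ≫ q = b ≫ q) (A B : X) :
    preimage (pair a b) (rect A B) =
      preimage (pair a b) (rect (A ⊓ preimage q (l B)) (preimage q (l A) ⊓ B)) := by
  have preimage_eq (W : Q) : preimage a (preimage q W) = preimage b (preimage q W) :=
    DFunLike.congr_fun (congrArg preimage hab) W
  have hA : preimage a A ≤ preimage b (preimage q (l A)) :=
    preimage_eq (l A) ▸ OrderHomClass.mono (preimage a) (gc.le_u_l A)
  have hB : preimage b B ≤ preimage a (preimage q (l B)) :=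
    preimage_eq (l B) ▸ OrderHomClass.mono (preimage b) (gc.le_u_l B)
  rw [preimage_pair_rect, preimage_pair_rect, map_inf, map_inf]
  exact le_antisymm
    (le_inf (le_inf inf_le_left (inf_le_right.trans hB))
      (le_inf (inf_le_left.trans hA) inf_le_right))
    (inf_le_inf inf_le_left inf_le_right)

theorem preimage_pair_eq_of_coneRel {a b : Z ⟶ X} (hab : a ≫ q = b ≫ q) (u v : FrameCoprod X X)
    (huv : coneRel (preimage q ∘ l) (preimage q ∘ l) u v) :
    preimage (pair a b) u = preimage (pair a b) v := by
  obtain ⟨A, B, C, D, rfl, rfl, hup, hdown⟩ := huv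
  simp only [Function.comp_apply] at hup hdown
  rw [preimage_pair_rect_eq_of_comp_eq gc hab, hup, hdown,
    ← preimage_pair_rect_eq_of_comp_eq gc hab]

theorem coneRel_preimage_rect_top (W : Q) :
    coneRel (preimage q ∘ l) (preimage q ∘ l) (rect (preimage q W) ⊤)
      (rect ⊤ (preimage q W)) := by
  have hW : preimage q (l (preimage q W)) = preimage q W := gc.u_l_u_eq_u W
  have htop : preimage q (l ⊤) = ⊤ := top_le_iff.1 (gc.le_u_l ⊤)
  exact ⟨_, _, _, _, rfl, rfl, by simp only [Function.comp_apply, hW, htop, inf_top_eq, top_inf_eq],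
    by simp only [Function.comp_apply, hW, htop, inf_top_eq, top_inf_eq]⟩

theorem isKernelPair_inducedRelation :
    IsKernelPair q (source (inducedRelation (preimage q ∘ l) (preimage q ∘ l)))
      (target (inducedRelation (preimage q ∘ l) (preimage q ∘ l))) := by
  refine isKernelPair_source_target_iff.2 ⟨?_, fun Z a b hab => ?_⟩
  · exact locale_hom_ext fun W => restrict_eq_of_rel (coneRel_preimage_rect_top gc W)
  · exact image_le_iff.2
      (exists_comp_incl_saturated (pair a b) (preimage_pair_eq_of_coneRel gc hab))

end KernelPair

section Cones

variable {X : Locale.{u}} {R : LocalicRelation X}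

theorem preimage_source_le_preimage_target_iff (hsymm : opposite R ≤ R) {U V : X} :
    preimage (source R) U ≤ preimage (target R) V ↔
      preimage (target R) U ≤ preimage (source R) V := by
  obtain ⟨i, his, hit⟩ := image_pair_le_iff.1 hsymm
  constructor
  · intro h
    simpa only [← preimage_comp_apply, his, hit] using OrderHomClass.mono (preimage i) h
  · intro h
    simpa only [← preimage_comp_apply, his, hit] using OrderHomClass.mono (preimage i) h

theorem downCone_eq_upCone (hsymm : opposite R ≤ R) : downCone R = upCone R :=
  funext fun _ => congrArg sInf <| Set.ext fun _ =>
    (preimage_source_le_preimage_target_iff hsymm).symm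

theorem upCone_le_iff (ht : IsOpenMap (target R)) {U V : X} :
    upCone R U ≤ V ↔ preimage (source R) U ≤ preimage (target R) V :=
  ht.gc _ _

theorem le_upCone (hrefl : diagonal X ≤ R) (ht : IsOpenMap (target R)) (U : X) :
    U ≤ upCone R U := by
  obtain ⟨d, hds, hdt⟩ := image_pair_le_iff.1 hrefl
  have h := OrderHomClass.mono (preimage d) ((upCone_le_iff ht).1 (le_refl (upCone R U)))
  rwa [← preimage_comp_apply, ← preimage_comp_apply, hds, hdt] at h

theorem preimage_source_upCone_le (htrans : composite R R ≤ R) (ht : IsOpenMap (target R)) (U : X) :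
    preimage (source R) (upCone R U) ≤ preimage (target R) (upCone R U) := by
  obtain ⟨m, hms, hmt⟩ := image_pair_le_iff.1 htrans
  have h := OrderHomClass.mono (preimage m) ((upCone_le_iff ht).1 (le_refl (upCone R U)))
  rw [← preimage_comp_apply, ← preimage_comp_apply, hms, hmt] at h
  exact (preimage_fst_le_preimage_snd_iff (IsPullback.of_hasPullback _ _) ht).1 h

theorem preimage_source_upCone (hR : IsEquivalence R) (ht : IsOpenMap (target R)) (U : X) :
    preimage (source R) (upCone R U) = preimage (target R) (upCone R U) :=
  have h := preimage_source_upCone_le hR.trans ht U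
  h.antisymm ((preimage_source_le_preimage_target_iff hR.symm.ge).1 h)

theorem upCone_le_iff_le (hrefl : diagonal X ≤ R) (ht : IsOpenMap (target R)) {U V : X}
    (hV : preimage (source R) V = preimage (target R) V) : upCone R U ≤ V ↔ U ≤ V :=
  ⟨(le_upCone hrefl ht U).trans, fun h =>
    (upCone_le_iff ht).2 (hV ▸ OrderHomClass.mono (preimage (source R)) h)⟩

theorem exists_gc_preimage_quotientMap (hR : IsEquivalence R) (ht : IsOpenMap (target R)) :
    ∃ l, GaloisConnection l (preimage (quotientMap R)) ∧
      upCone R = preimage (quotientMap R) ∘ l := by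
  choose l hl using fun U => exists_preimage_coequalizer_π_eq (preimage_source_upCone hR ht U)
  refine ⟨l, fun U W => ?_, funext fun U => (hl U).symm⟩
  rw [← preimage_coequalizer_π_le_iff, hl]
  exact upCone_le_iff_le hR.refl ht (preimage_coequalizer_π_condition W)

theorem isKernelPair_upDown (hR : IsEquivalence R) (ht : IsOpenMap (target R)) :
    IsKernelPair (quotientMap R) (source (upDown R)) (target (upDown R)) := by
  obtain ⟨l, gc, hl⟩ := exists_gc_preimage_quotientMap hR ht
  rw [upDown, downCone_eq_upCone hR.symm.ge, hl]
  exact isKernelPair_inducedRelation gc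

end Cones

end LocalicRel

theorem mainTheorem8 (X : Locale.{u}) (R : LocalicRel.LocalicRelation X)
    (hR : LocalicRel.IsEquivalence R) (hopen : LocalicRel.HasOpenCones R) :
    ∃ e : LocalicRel.subLoc (LocalicRel.upDown R) ≅
        LocalicRel.kernelPair (LocalicRel.quotientMap R),
      e.hom ≫ LocalicRel.kernelPairMap (LocalicRel.quotientMap R) =
        LocalicRel.incl (LocalicRel.upDown R) ∧
      ∃ h : R ≤ LocalicRel.upDown R,
        LocalicRel.inclOfLE h ≫ e.hom = LocalicRel.kockInclusion R := by
  have hker := LocalicRel.isKernelPair_upDown hR hopen.target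
  have hle : R ≤ LocalicRel.upDown R :=
    LocalicRel.le_of_isKernelPair hker (coequalizer.condition _ _)
  have he := LocalicRel.isoPullback_hom_comp_kernelPairMap hker
  refine ⟨hker.isoPullback, he, hle, ?_⟩
  rw [← cancel_mono (LocalicRel.kernelPairMap (LocalicRel.quotientMap R)), Category.assoc, he,
    LocalicRel.inclOfLE_incl, LocalicRel.kockInclusion_kernelPairMap]
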